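/- Let $\Gamma$ be a finite simplicial graph with vertex set $V(\Gamma)$, edge set $E(\Gamma)$ and an edge-labeling $m\colon E(\Gamma)\to\{2,3,4,\dots\}$, and let $$A_\Gamma=\langle V(\Gamma)\mid \underbrace{vwv\cdots}_{m(\{v,w\})\text{ letters}}=\underbrace{wvw\cdots}_{m(\{v,w\})\text{ letters}}\ \text{ whenever } \{v,w\}\in E(\Gamma)\rangle$$ be the associated Artin group. For $X\subseteq V(\Gamma)$ let $A_X$ be the subgroup of $A_\Gamma$ generated by $X$; a subgroup of $A_\Gamma$ is called parabolic if it is of the form $gA_Xg^{-1}$ with $g\in A_\Gamma$ and $X\subseteq V(\Gamma)$. Suppose that $A_\Gamma$ has property (Int++): for all parabolic subgroups $P_1,P_2$ of $A_\Gamma$, the intersection $P_1\cap P_2$ is a parabolic subgroup of $A_\Gamma$. Then the intersection $\bigcap_{P\in N}P$ of an arbitrary (possibly infinite) set $N$ of parabolic subgroups of $A_\Gamma$ is a parabolic subgroup of $A_\Gamma$ (where the intersection of the empty set of subgroups is $A_\Gamma$). In particular, for every subset $B\subseteq A_\Gamma$ there exists the parabolic closure of $B$, that is, among the parabolic subgroups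 of $A_\Gamma$ containing $B$ there is a unique one that is minimal with respect to inclusion. -/

import Mathlib

/-- A simplicial graph `Γ` on the vertex set `V`, together with an edge-labeling
`m : E(Γ) → {2, 3, 4, …}`. -/
structure LabeledGraph (V : Type*) where
  /-- the underlying simplicial graph -/
  graph : SimpleGraph V
  /-- the edge-labeling -/
  m : graph.edgeSet → ℕ
  /-- all the labels are at least two -/
  two_le_m : ∀ e, 2 ≤ m e

/-- The alternating product `a * b * a * ⋯` with `n` factors, starting with `a`. -/
def altProd {G : Type*} [Monoid G] (a b : G) : ℕ → G
  | 0 => 1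
  | n + 1 => a * altProd b a n

namespace LabeledGraph

variable {V : Type*} (Γ : LabeledGraph V)

/-- The relators `(v w v ⋯) (w v w ⋯)⁻¹`, with `m {v, w}` letters in each of the two words,
one for each adjacent pair `v, w`. -/
def artinRels : Set (FreeGroup V) :=
  {r | ∃ (v w : V) (h : Γ.graph.Adj v w),
    r = altProd (FreeGroup.of v) (FreeGroup.of w) (Γ.m ⟨s(v, w), h⟩) *
      (altProd (FreeGroup.of w) (FreeGroup.of v) (Γ.m ⟨s(v, w), h⟩))⁻¹}

/-- The Artin group `A_Γ`, given by its presentation. -/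
abbrev ArtinGroup : Type _ := PresentedGroup Γ.artinRels

/-- The standard parabolic subgroup `A_X`, generated by a set `X` of vertices. -/
def standardParabolic (X : Set V) : Subgroup Γ.ArtinGroup :=
  Subgroup.closure ((PresentedGroup.of : V → Γ.ArtinGroup) '' X)

/-- A parabolic subgroup of `A_Γ` is a conjugate `g A_X g⁻¹` of a standard parabolic subgroup. -/
def IsParabolic (P : Subgroup Γ.ArtinGroup) : Prop :=
  ∃ (g : Γ.ArtinGroup) (X : Set V),
    P = (Γ.standardParabolic X).map (MulAut.conj g).toMonoidHom

/-- Property (Int++): the intersection of any two parabolic subgroups is parabolic. -/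
def IntPlusPlus : Prop :=
  ∀ P₁ P₂ : Subgroup Γ.ArtinGroup,
    Γ.IsParabolic P₁ → Γ.IsParabolic P₂ → Γ.IsParabolic (P₁ ⊓ P₂)

/-- `P` is minimal, with respect to inclusion, among the parabolic subgroups containing `B`. -/
def IsMinimalParabolicContaining (B : Set Γ.ArtinGroup) (P : Subgroup Γ.ArtinGroup) : Prop :=
  Minimal (fun Q : Subgroup Γ.ArtinGroup => Γ.IsParabolic Q ∧ B ⊆ (Q : Set Γ.ArtinGroup)) P

/-- `P` is the parabolic closure of `B`: the unique minimal parabolic subgroup containing `B`. -/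
def IsParabolicClosure (B : Set Γ.ArtinGroup) (P : Subgroup Γ.ArtinGroup) : Prop :=
  Γ.IsMinimalParabolicContaining B P ∧
    ∀ Q : Subgroup Γ.ArtinGroup, Γ.IsMinimalParabolicContaining B Q → Q = P

end LabeledGraph

/-! Given (Int++), it suffices that parabolic subgroups satisfy the descending chain condition: a
minimal parabolic Q containing ⋂N must lie in each P ∈ N, since Q ∩ P is again parabolic. As V has
finitely many subsets, an infinite strictly descending chain would contain a proper inclusion
between two conjugates of one A_X. So everything rests on `map_conj_standardParabolic_eq_of_le`:
gA_Xg⁻¹ ≤ A_X forces equality.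

For this, A_Γ acts on pairs (w, b), with w a minimal representative of a coset in W/W_X of the
Coxeter group and b ∈ A_Γ. A generator s sends (w, b) to (sw, b) if it moves the coset, and to (w,
xb) if w⁻¹sw = x ∈ X. Cosets are handled by roots in the geometric representation; positivity of
roots makes the action well defined and yields the braid relations (`altRun_cosetPerm_comm`).

Put (w, h) = g⁻¹·(1, 1), so h ∈ A_X. If gA_Xg⁻¹ ≤ A_X, each x ∈ X sends (w, h) to (w, h·gxg⁻¹), so x
fixes the coset with a label φ(x) ∈ X and φ(x) = (hg)x(hg)⁻¹. The map φ is injective on the finite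
set X, hence bijective, so hg normalizes A_X, and so does g. -/

/-! ### The ratios sin(nθ)/sin θ -/

/-- The sequence `0, 1, c, c ^ 2 - 1, …` given by `u (n + 2) = c * u (n + 1) - u n`. -/
def sineRatio (c : ℝ) : ℕ → ℝ
  | 0 => 0
  | 1 => 1
  | n + 2 => c * sineRatio c (n + 1) - sineRatio c n

theorem sineRatio_two_cos_mul_sin (θ : ℝ) :
    ∀ n : ℕ, sineRatio (2 * Real.cos θ) n * Real.sin θ = Real.sin (n * θ)
  | 0 => by simp [sineRatio]
  | 1 => by simp [sineRatio]
  | n + 2 => by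
    have h1 := sineRatio_two_cos_mul_sin θ (n + 1)
    have h0 := sineRatio_two_cos_mul_sin θ n
    have e2 : ((n + 2 : ℕ) : ℝ) * θ = (n + 1 : ℕ) * θ + θ := by push_cast; ring
    have e0 : (n : ℝ) * θ = (n + 1 : ℕ) * θ - θ := by push_cast; ring
    rw [e0, Real.sin_sub] at h0
    rw [e2, Real.sin_add, sineRatio]
    linear_combination 2 * Real.cos θ * h1 - h0

theorem sineRatio_two : ∀ n : ℕ, sineRatio 2 n = n
  | 0 => by simp [sineRatio]
  | 1 => by simp [sineRatio]
  | n + 2 => by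
    rw [sineRatio, sineRatio_two (n + 1), sineRatio_two n]; push_cast; ring

section

variable {m : ℕ}

theorem sin_pi_div_pos (hm : 2 ≤ m) : 0 < Real.sin (Real.pi / m) := by
  have h : (2 : ℝ) ≤ m := by exact_mod_cast hm
  apply Real.sin_pos_of_pos_of_lt_pi
  · have := Real.pi_pos; positivity
  · exact div_lt_self Real.pi_pos (by linarith)

theorem sineRatio_eq_div (hm : 2 ≤ m) (n : ℕ) :
    sineRatio (2 * Real.cos (Real.pi / m)) n =
      Real.sin (n * (Real.pi / m)) / Real.sin (Real.pi / m) := by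
  rw [eq_div_iff (sin_pi_div_pos hm).ne', sineRatio_two_cos_mul_sin]

theorem sineRatio_pos (hm : 2 ≤ m) {n : ℕ} (h0 : 0 < n) (hn : n < m) :
    0 < sineRatio (2 * Real.cos (Real.pi / m)) n := by
  rw [sineRatio_eq_div hm]
  refine div_pos (Real.sin_pos_of_pos_of_lt_pi ?_ ?_) (sin_pi_div_pos hm)
  · have := Real.pi_pos
    have : (0 : ℝ) < m := by exact_mod_cast (by omega : 0 < m)
    positivity
  · have h : (n : ℝ) < m := by exact_mod_cast hn
    have hm' : (0 : ℝ) < m := by exact_mod_cast (by omega : 0 < m)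
    rw [mul_div_assoc', div_lt_iff₀ hm']
    nlinarith [Real.pi_pos]

theorem sineRatio_self (hm : 2 ≤ m) : sineRatio (2 * Real.cos (Real.pi / m)) m = 0 := by
  have hm' : (m : ℝ) ≠ 0 := by exact_mod_cast (by omega : m ≠ 0)
  rw [sineRatio_eq_div hm, mul_div_cancel₀ _ hm', Real.sin_pi, zero_div]

theorem sineRatio_add_self (hm : 2 ≤ m) (n : ℕ) :
    sineRatio (2 * Real.cos (Real.pi / m)) (n + m) =
      -sineRatio (2 * Real.cos (Real.pi / m)) n := by
  have hm' : (m : ℝ) ≠ 0 := by exact_mod_cast (by omega : m ≠ 0)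
  rw [sineRatio_eq_div hm, sineRatio_eq_div hm, Nat.cast_add, add_mul, mul_div_cancel₀ _ hm',
    Real.sin_add_pi, neg_div]

theorem sineRatio_pred (hm : 2 ≤ m) : sineRatio (2 * Real.cos (Real.pi / m)) (m - 1) = 1 := by
  have h := sineRatio_add_self hm 1
  obtain ⟨n, rfl⟩ : ∃ n, m = n + 2 := ⟨m - 2, by omega⟩
  have h0 := sineRatio_self hm
  rw [show 1 + (n + 2) = (n + 1) + 2 by ring, sineRatio.eq_3, show n + 1 + 1 = n + 2 by ring,
    h0] at h
  have h1 : sineRatio (2 * Real.cos (Real.pi / (n + 2 : ℕ))) 1 = 1 := rfl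
  rw [h1] at h
  change sineRatio _ (n + 1) = 1
  linarith

/-- Here m = 0 encodes ∞: then π / 0 = 0 in Lean, so the parameter is 2 and the sequence is n
itself. -/
theorem sineRatio_nonneg (hm : m ≠ 1) {n : ℕ} (hn : m ≠ 0 → n ≤ m) :
    0 ≤ sineRatio (2 * Real.cos (Real.pi / m)) n := by
  rcases Nat.eq_zero_or_pos m with rfl | h0
  · simp [sineRatio_two]
  · have h2 : 2 ≤ m := by omega
    rcases Nat.eq_zero_or_pos n with rfl | hn0
    · simp [sineRatio]
    rcases (hn h0.ne').lt_or_eq with h | rfl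
    · exact (sineRatio_pos h2 hn0 h).le
    · exact (sineRatio_self h2).ge

end

/-! ### The geometric representation of a Coxeter group -/

namespace CoxeterMatrix

variable {V : Type*} (M : CoxeterMatrix V)

/-- The simple roots, as the standard basis. -/
noncomputable abbrev simpleRoot (s : V) : V →₀ ℝ := Finsupp.single s 1

/-- Minus twice the canonical bilinear form on two simple roots. -/
noncomputable def edgeWeight (s t : V) : ℝ := 2 * Real.cos (Real.pi / M s t)

theorem edgeWeight_comm (s t : V) : M.edgeWeight s t = M.edgeWeight t s := by
  rw [edgeWeight, edgeWeight, M.symmetric]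

theorem edgeWeight_self (s : V) : M.edgeWeight s s = -2 := by
  simp [edgeWeight]

/-- Twice the canonical bilinear form. -/
noncomputable def form : (V →₀ ℝ) →ₗ[ℝ] (V →₀ ℝ) →ₗ[ℝ] ℝ :=
  Finsupp.linearCombination ℝ fun s => Finsupp.linearCombination ℝ fun t => -M.edgeWeight s t

@[simp] theorem form_simpleRoot (s t : V) :
    M.form (simpleRoot s) (simpleRoot t) = -M.edgeWeight s t := by
  simp [form, simpleRoot]

theorem form_comm (v w : V →₀ ℝ) : M.form v w = M.form w v := by
  have : M.form = M.form.flip := by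
    ext s t
    simpa using M.edgeWeight_comm s t
  exact LinearMap.congr_fun₂ this v w

theorem form_simpleRoot_self (s : V) : M.form (simpleRoot s) (simpleRoot s) = 2 := by
  rw [form_simpleRoot, edgeWeight_self, neg_neg]

/-- The simple reflections of the geometric representation. -/
noncomputable def simpleReflection (s : V) : (V →₀ ℝ) ≃ₗ[ℝ] (V →₀ ℝ) :=
  Module.reflection (M.form_simpleRoot_self s)

theorem simpleReflection_apply (s : V) (v : V →₀ ℝ) :
    M.simpleReflection s v = v - M.form (simpleRoot s) v • simpleRoot s :=
  Module.reflection_apply _ _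

theorem simpleReflection_simpleRoot (s t : V) :
    M.simpleReflection s (simpleRoot t) = simpleRoot t + M.edgeWeight s t • simpleRoot s := by
  rw [simpleReflection_apply, form_simpleRoot, neg_smul, sub_neg_eq_add]

theorem simpleReflection_simpleRoot_self (s : V) :
    M.simpleReflection s (simpleRoot s) = -simpleRoot s :=
  Module.reflection_apply_self _

theorem simpleReflection_mul_self (s : V) : M.simpleReflection s * M.simpleReflection s = 1 :=
  LinearEquiv.ext (Module.involutive_reflection (M.form_simpleRoot_self s))

theorem form_simpleReflection (s : V) (v w : V →₀ ℝ) :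
    M.form (M.simpleReflection s v) (M.simpleReflection s w) = M.form v w := by
  simp only [simpleReflection_apply, map_sub, map_smul, LinearMap.sub_apply, LinearMap.smul_apply,
    smul_eq_mul, form_simpleRoot_self, M.form_comm v (simpleRoot s)]
  ring

/-- The letters `t, s, t, s, …`. -/
def altLetter (s t : V) (n : ℕ) : V := if Even n then t else s

theorem altLetter_zero (s t : V) : altLetter s t 0 = t := by simp [altLetter]

theorem altLetter_add_one (s t : V) (n : ℕ) : altLetter s t (n + 1) = altLetter t s n := by
  unfold altLetter; split_ifs <;> grind

theorem edgeWeight_altLetter (s t : V) (n : ℕ) :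
    M.edgeWeight (altLetter s t n) (altLetter t s n) = M.edgeWeight s t := by
  unfold altLetter; split_ifs
  · exact M.edgeWeight_comm t s
  · rfl

theorem simpleReflection_altLetter (s t : V) (n : ℕ) :
    M.simpleReflection (altLetter s t n)
      (sineRatio (M.edgeWeight s t) (n + 1) • simpleRoot (altLetter t s n) +
        sineRatio (M.edgeWeight s t) n • simpleRoot (altLetter s t n)) =
      sineRatio (M.edgeWeight s t) (n + 2) • simpleRoot (altLetter s t n) +
        sineRatio (M.edgeWeight s t) (n + 1) • simpleRoot (altLetter t s n) := by
  rw [map_add, map_smul, map_smul, simpleReflection_simpleRoot, simpleReflection_simpleRoot_self,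
    edgeWeight_altLetter, sineRatio]
  module

theorem pow_mul_simpleReflection_apply (s t : V) (n : ℕ) :
    ((M.simpleReflection s * M.simpleReflection t) ^ n) (simpleRoot s) =
      sineRatio (M.edgeWeight s t) (2 * n + 1) • simpleRoot s +
        sineRatio (M.edgeWeight s t) (2 * n) • simpleRoot t := by
  induction n with
  | zero => simp [sineRatio]
  | succ n ih =>
    have h0 := M.simpleReflection_altLetter s t (2 * n)
    have h1 := M.simpleReflection_altLetter s t (2 * n + 1)
    have e : Even (2 * n) := even_two_mul n
    have e' : ¬ Even (2 * n + 1) := by simp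
    simp only [altLetter, e, e', if_true, if_false] at h0 h1
    rw [pow_succ', LinearEquiv.mul_apply, ih, LinearEquiv.mul_apply, h0, h1]
    rfl

theorem pow_mul_simpleReflection_simpleRoot {s t : V} (h : 2 ≤ M s t) :
    ((M.simpleReflection s * M.simpleReflection t) ^ M s t) (simpleRoot s) = simpleRoot s := by
  rw [pow_mul_simpleReflection_apply, edgeWeight, show 2 * M s t + 1 = 1 + M s t + M s t by ring,
    two_mul (M s t), sineRatio_add_self h, sineRatio_add_self h, sineRatio_add_self h, sineRatio_self h]
  simp [sineRatio]

/-- For finite M s t the form is nondegenerate on the plane of the two roots, so the space is this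
plane plus its orthogonal complement. The power of the product fixes both roots, by the
antiperiodicity of the sine ratios, and fixes the complement pointwise. -/
theorem isLiftable_simpleReflection : M.IsLiftable M.simpleReflection := by
  intro s t
  rcases eq_or_ne s t with rfl | hst
  · simpa using M.simpleReflection_mul_self s
  rcases Nat.eq_zero_or_pos (M s t) with h0 | h0
  · rw [h0, pow_zero]
  have h2 : 2 ≤ M s t := by have := M.off_diagonal s t hst; omega
  set g := (M.simpleReflection s * M.simpleReflection t) ^ M s t with hg
  have hs : g (simpleRoot s) = simpleRoot s := M.pow_mul_simpleReflection_simpleRoot h2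
  have ht : g (simpleRoot t) = simpleRoot t := by
    have h := M.pow_mul_simpleReflection_simpleRoot (s := t) (t := s) (by rwa [M.symmetric])
    have hinv : (M.simpleReflection t * M.simpleReflection s) ^ M t s = g⁻¹ := by
      rw [hg, M.symmetric t s, ← inv_pow, mul_inv_rev]; rfl
    rw [hinv] at h
    rw [← h, ← LinearEquiv.mul_apply, mul_inv_cancel, h]; rfl
  have hfix : ∀ v, M.form (simpleRoot s) v = 0 → M.form (simpleRoot t) v = 0 → g v = v := by
    intro v hs ht
    have h1 : (M.simpleReflection s * M.simpleReflection t) v = v := by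
      rw [LinearEquiv.mul_apply, simpleReflection_apply, simpleReflection_apply, ht]; simp [hs]
    rw [hg]
    generalize M s t = n
    induction n with
    | zero => rfl
    | succ n ih => rw [pow_succ, LinearEquiv.mul_apply, h1, ih]
  ext1 v
  set c := M.edgeWeight s t with hc
  set p := M.form (simpleRoot s) v with hp
  set q := M.form (simpleRoot t) v with hq
  have hdet : 4 - c ^ 2 ≠ 0 := by
    have := Real.sin_sq_add_cos_sq (Real.pi / M s t)
    have := sin_pi_div_pos h2
    rw [hc, edgeWeight]
    nlinarith
  -- Cramer's rule for the orthogonal projection of v to the plane; the Gram matrix has determinant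
  -- 4 - c².
  set a := (2 * p + c * q) / (4 - c ^ 2) with ha
  set b := (c * p + 2 * q) / (4 - c ^ 2) with hb
  set v₀ := v - (a • simpleRoot s + b • simpleRoot t) with hv
  have h0 : g v₀ = v₀ := by
    apply hfix
    · rw [hv, map_sub, map_add, map_smul, map_smul, form_simpleRoot_self, form_simpleRoot, ← hc,
        ← hp, ha, hb, smul_eq_mul, smul_eq_mul]
      field_simp
      ring
    · rw [hv, map_sub, map_add, map_smul, map_smul, form_simpleRoot_self, form_simpleRoot,
        M.edgeWeight_comm t s, ← hc, ← hq, ha, hb, smul_eq_mul, smul_eq_mul]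
      field_simp
      ring
  have hv' : v = v₀ + (a • simpleRoot s + b • simpleRoot t) := by rw [hv]; abel
  rw [hv', map_add, map_add, map_smul, map_smul, hs, ht, h0]; rfl

/-- The geometric representation. -/
noncomputable def geometricRep : M.Group →* ((V →₀ ℝ) ≃ₗ[ℝ] (V →₀ ℝ)) :=
  M.toCoxeterSystem.lift ⟨M.simpleReflection, M.isLiftable_simpleReflection⟩

local notation "ρ" => M.geometricRep
local notation "cs" => M.toCoxeterSystem

@[simp] theorem geometricRep_simple (s : V) : ρ ((cs).simple s) = M.simpleReflection s :=
  CoxeterSystem.lift_apply_simple _ M.isLiftable_simpleReflection s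

theorem geometricRep_apply_inv_apply (w : M.Group) (v : V →₀ ℝ) : ρ w (ρ w⁻¹ v) = v := by
  rw [← LinearEquiv.mul_apply, ← map_mul, mul_inv_cancel, map_one]; rfl

theorem geometricRep_inv_apply_apply (w : M.Group) (v : V →₀ ℝ) : ρ w⁻¹ (ρ w v) = v := by
  rw [← LinearEquiv.mul_apply, ← map_mul, inv_mul_cancel, map_one]; rfl

theorem geometricRep_mul_simple (w : M.Group) (s : V) :
    ρ (w * (cs).simple s) (simpleRoot s) = -ρ w (simpleRoot s) := by
  rw [map_mul, LinearEquiv.mul_apply, geometricRep_simple, simpleReflection_simpleRoot_self,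
    map_neg]

theorem form_geometricRep (w : M.Group) (v v' : V →₀ ℝ) :
    M.form (ρ w v) (ρ w v') = M.form v v' := by
  induction w using (cs).simple_induction_left with
  | one => simp
  | mul_simple_left w s ih =>
    rw [map_mul, LinearEquiv.mul_apply, LinearEquiv.mul_apply, geometricRep_simple,
      form_simpleReflection, ih]

/-! ### Positivity of roots -/

/-- The product `⋯ s t s t` with `n` factors. -/
noncomputable def altElt (s t : V) (n : ℕ) : M.Group :=
  (cs).wordProd (CoxeterSystem.alternatingWord s t n)

theorem altElt_zero (s t : V) : M.altElt s t 0 = 1 := by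
  simp [altElt, CoxeterSystem.alternatingWord]

theorem altElt_succ (s t : V) (n : ℕ) :
    M.altElt s t (n + 1) = (cs).simple (altLetter s t n) * M.altElt s t n := by
  rw [altElt, CoxeterSystem.alternatingWord_succ', CoxeterSystem.wordProd_cons]; rfl

theorem altElt_succ' (s t : V) (n : ℕ) :
    M.altElt s t (n + 1) = M.altElt t s n * (cs).simple t := by
  rw [altElt, CoxeterSystem.alternatingWord_succ, CoxeterSystem.wordProd_concat]; rfl

theorem altElt_comm (s t : V) : M.altElt s t (M s t) = M.altElt t s (M s t) := by
  have := (cs).wordProd_braidWord_eq s t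
  rwa [CoxeterSystem.braidWord, CoxeterSystem.braidWord, M.symmetric t s] at this

theorem length_altElt_le (s t : V) (n : ℕ) : (cs).length (M.altElt s t n) ≤ n := by
  simpa [altElt] using (cs).length_wordProd_le (CoxeterSystem.alternatingWord s t n)

theorem geometricRep_altElt (s t : V) (n : ℕ) :
    ρ (M.altElt s t n) (simpleRoot s) =
      sineRatio (M.edgeWeight s t) (n + 1) • simpleRoot (altLetter t s n) +
        sineRatio (M.edgeWeight s t) n • simpleRoot (altLetter s t n) := by
  induction n with
  | zero => simp [altElt_zero, altLetter_zero, sineRatio]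
  | succ n ih =>
    rw [altElt_succ, map_mul, LinearEquiv.mul_apply, ih, geometricRep_simple,
      simpleReflection_altLetter, altLetter_add_one, altLetter_add_one]

/-- Walking down from `w` along the right multiplications by `t, s, t, …`. -/
theorem exists_eq_mul_altElt (w : M.Group) (s t : V) :
    ∃ (n : ℕ) (v : M.Group), w = v * M.altElt s t n ∧
      (cs).length w = (cs).length v + n ∧
      (cs).length v < (cs).length (v * (cs).simple (altLetter s t n)) ∧
      ∀ j < n, ∃ v' : M.Group, w = v' * M.altElt s t (j + 1) ∧
        (cs).length w = (cs).length v' + (j + 1) := by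
  have step : ∀ (n : ℕ) (v : M.Group), w = v * M.altElt s t n →
      w = v * (cs).simple (altLetter s t n) * M.altElt s t (n + 1) := by
    intro n v h
    rw [altElt_succ, ← mul_assoc, CoxeterSystem.simple_mul_simple_cancel_right, ← h]
  classical
  let P : ℕ → Prop := fun n => ∃ v, w = v * M.altElt s t n ∧ (cs).length w = (cs).length v + n
  have hP : ∃ n, ¬ P n := ⟨(cs).length w + 1, fun ⟨v, _, h⟩ => by omega⟩
  have h0 : P 0 := ⟨w, by simp [altElt_zero], by simp⟩
  have hpos : Nat.find hP ≠ 0 := fun h => (h ▸ Nat.find_spec hP) h0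
  obtain ⟨n, hn⟩ := Nat.exists_eq_succ_of_ne_zero hpos
  have hlt : ∀ j ≤ n, P j := fun j hj => not_not.1 (Nat.find_min hP (by omega))
  obtain ⟨v, hv, hl⟩ := hlt n le_rfl
  refine ⟨n, v, hv, hl, ?_, fun j hj => hlt (j + 1) hj⟩
  rcases (cs).length_mul_simple v (altLetter s t n) with h | h
  · omega
  · refine absurd ⟨_, step n v hv, ?_⟩ (hn ▸ Nat.find_spec hP)
    omega

/-- Induction on length: with t a right descent of w, strip letters t, s, t, … as long as the length
drops. The remaining v sends both simple roots to nonnegative vectors, and the stripped dihedral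
element sends the root of s to a combination of them with sine ratios as coefficients. -/
theorem geometricRep_nonneg_of_length_lt (w : M.Group) (s : V)
    (h : (cs).length w < (cs).length (w * (cs).simple s)) : 0 ≤ ρ w (simpleRoot s) := by
  induction hl : (cs).length w using Nat.strong_induction_on generalizing w s with
  | _ l ih =>
  subst hl
  rcases eq_or_ne w 1 with rfl | hw
  · simp
  obtain ⟨t, ht⟩ := (cs).exists_rightDescent_of_ne_one hw
  rw [CoxeterSystem.IsRightDescent] at ht
  have hst : s ≠ t := by rintro rfl; omega
  obtain ⟨n, v, hv, hlen, hup, hbelow⟩ := M.exists_eq_mul_altElt w s t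
  obtain ⟨n, rfl⟩ : ∃ k, n = k + 1 := by
    rcases n with _ | n
    · rw [altElt_zero, mul_one] at hv
      rw [altLetter_zero, ← hv] at hup
      omega
    · exact ⟨n, rfl⟩
  have hup' : (cs).length v < (cs).length (v * (cs).simple (altLetter s t n)) := by
    have e : w = v * (cs).simple (altLetter s t n) * M.altElt s t n := by
      rw [mul_assoc, ← altElt_succ, ← hv]
    have h1 := (cs).length_mul_le (v * (cs).simple (altLetter s t n)) (M.altElt s t n)
    have h2 := M.length_altElt_le s t n
    rw [← e] at h1
    omega
  -- With M s t letters stripped, the braid relation would let w end in s, making s a right descent.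
  have hm : M s t ≠ 0 → n + 1 < M s t := by
    intro hm
    by_contra! hn
    obtain ⟨k, hk⟩ := Nat.exists_eq_succ_of_ne_zero hm
    obtain ⟨v', hv', hl'⟩ := hbelow k (by omega)
    rw [← Nat.succ_eq_add_one, ← hk, altElt_comm, hk, altElt_succ', ← mul_assoc] at hv'
    have e : w * (cs).simple s = v' * M.altElt s t k := by
      rw [hv', CoxeterSystem.simple_mul_simple_cancel_right]
    have h1 := (cs).length_mul_le v' (M.altElt s t k)
    have h2 := M.length_altElt_le s t k
    rw [← e] at h1
    omega
  have i1 := ih _ (by omega) v _ hup rfl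
  have i2 := ih _ (by omega) v _ hup' rfl
  have hoff : M s t ≠ 1 := M.off_diagonal s t hst
  have i3 := sineRatio_nonneg hoff (n := n + 2) fun h => hm h
  have i4 := sineRatio_nonneg hoff (n := n + 1) fun h => (hm h).le
  rw [hv, map_mul, LinearEquiv.mul_apply, geometricRep_altElt, map_add, map_smul, map_smul]
  have e : altLetter t s (n + 1) = altLetter s t n := altLetter_add_one t s n
  rw [e]
  exact add_nonneg (smul_nonneg i3 i2) (smul_nonneg i4 i1)

theorem geometricRep_nonpos_of_length_lt (w : M.Group) (s : V)
    (h : (cs).length (w * (cs).simple s) < (cs).length w) : ρ w (simpleRoot s) ≤ 0 := by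
  have := M.geometricRep_nonneg_of_length_lt (w * (cs).simple s) s
    (by rwa [CoxeterSystem.simple_mul_simple_cancel_right])
  rw [geometricRep_mul_simple] at this
  exact neg_nonneg.1 this

theorem geometricRep_nonneg_or_nonpos (w : M.Group) (s : V) :
    0 ≤ ρ w (simpleRoot s) ∨ ρ w (simpleRoot s) ≤ 0 := by
  rcases (cs).length_mul_simple w s with h | h
  · exact .inl (M.geometricRep_nonneg_of_length_lt w s (by omega))
  · exact .inr (M.geometricRep_nonpos_of_length_lt w s (by omega))

end CoxeterMatrix

/-! ### Alternating words and minimal coset representatives -/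

namespace CoxeterMatrix

variable {V : Type*} (M : CoxeterMatrix V)

local notation "ρ" => M.geometricRep
local notation "cs" => M.toCoxeterSystem

theorem altLetter_congr (s t : V) {i j : ℕ} (h : i % 2 = j % 2) :
    altLetter s t i = altLetter s t j := by
  simp only [altLetter, Nat.even_iff, h]

theorem altLetter_altLetter (s t : V) (j k : ℕ) :
    altLetter (altLetter s t (j + 1)) (altLetter s t j) k = altLetter s t (j + k) := by
  simp only [altLetter, Nat.even_iff]
  split_ifs <;> first | rfl | omega

/-- The product `⋯ φ s * φ t * φ s * φ t` with `n` factors. -/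
def altRun {H : Type*} [Monoid H] (φ : V → H) (s t : V) : ℕ → H
  | 0 => 1
  | n + 1 => φ (altLetter s t n) * altRun φ s t n

theorem altProd_eq_altRun {H : Type*} [Monoid H] (φ : V → H) (s t : V) (n : ℕ) :
    altProd (φ s) (φ t) n = if Even n then altRun φ s t n else altRun φ t s n := by
  induction n generalizing s t with
  | zero => simp [altProd, altRun]
  | succ n ih =>
    rw [altProd, ih]
    by_cases h : Even n
    · simp [h, altRun, altLetter, Nat.even_add_one]
    · simp [h, altRun, altLetter, Nat.even_add_one]

theorem altProd_comm_iff {H : Type*} [Monoid H] (φ : V → H) (s t : V) (n : ℕ) :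
    altProd (φ s) (φ t) n = altProd (φ t) (φ s) n ↔ altRun φ s t n = altRun φ t s n := by
  rw [altProd_eq_altRun, altProd_eq_altRun]
  split_ifs
  · rfl
  · exact eq_comm

theorem altRun_apply_of_steps {Ω : Type*} (σ : V → Equiv.Perm Ω) (s t : V) (z : ℕ → Ω) (n : ℕ)
    (h : ∀ k < n, σ (altLetter s t k) (z k) = z (k + 1)) : altRun σ s t n (z 0) = z n := by
  induction n with
  | zero => rfl
  | succ n ih =>
    rw [altRun, Equiv.Perm.mul_apply, ih fun k hk => h k (hk.trans n.lt_succ_self),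
      h n n.lt_succ_self]

theorem geometricRep_inv_altElt (s t : V) (n : ℕ) :
    ρ (M.altElt s t n)⁻¹ (simpleRoot (altLetter s t n)) =
      sineRatio (M.edgeWeight s t) (n + 1) • simpleRoot t +
        sineRatio (M.edgeWeight s t) n • simpleRoot s := by
  induction n generalizing s t with
  | zero => simp [altElt_zero, altLetter_zero, sineRatio]
  | succ n ih =>
    rw [altElt_succ', mul_inv_rev, map_mul, LinearEquiv.mul_apply, altLetter_add_one, ih,
      CoxeterSystem.inv_simple, geometricRep_simple, map_add, map_smul, map_smul,
      simpleReflection_simpleRoot, simpleReflection_simpleRoot_self, M.edgeWeight_comm t s,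
      sineRatio]
    module

/-- The shortest representatives of the left cosets of the subgroup generated by `X`. -/
def IsMinimalRep (X : Set V) (w : M.Group) : Prop := ∀ x ∈ X, 0 ≤ ρ w (simpleRoot x)

theorem isMinimalRep_one (X : Set V) : M.IsMinimalRep X 1 := fun x _ => by simp

/-- The coset of `w` is fixed by `s`. -/
def HasLabel (w : M.Group) (s x : V) : Prop := ρ w (simpleRoot x) = simpleRoot s

variable {M} in
theorem HasLabel.label_unique {w : M.Group} {s x y : V} (hx : M.HasLabel w s x)
    (hy : M.HasLabel w s y) : x = y :=
  Finsupp.single_left_injective one_ne_zero ((ρ w).injective (hx.trans hy.symm))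

theorem eq_one_of_geometricRep_eq_smul {w : M.Group} {s x : V} {c : ℝ} (hc : 0 ≤ c)
    (h : ρ w (simpleRoot x) = c • simpleRoot s) : c = 1 := by
  have h2 := M.form_geometricRep w (simpleRoot x) (simpleRoot x)
  rw [h, map_smul, map_smul, LinearMap.smul_apply, form_simpleRoot_self, form_simpleRoot_self,
    smul_eq_mul, smul_eq_mul] at h2
  nlinarith

theorem eq_smul_simpleRoot {v : V →₀ ℝ} {x : V} (h : ∀ y, y ≠ x → v y = 0) :
    v = v x • simpleRoot x := by
  ext y
  rcases eq_or_ne y x with rfl | hy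
  · simp
  · simp [h y hy, hy.symm]

/-- The reflection in s changes only the s-coordinate. If it turns a nonnegative root into a
nonpositive one, that root is a multiple of the simple root of s, hence equal to it by invariance of
the form. -/
theorem IsMinimalRep.simple_mul {X : Set V} {w : M.Group} {s : V} (hw : M.IsMinimalRep X w)
    (hs : ∀ x ∈ X, ¬ M.HasLabel w s x) : M.IsMinimalRep X ((cs).simple s * w) := by
  intro x hx
  refine (M.geometricRep_nonneg_or_nonpos _ x).resolve_right fun hneg => hs x hx ?_
  rw [map_mul, LinearEquiv.mul_apply, geometricRep_simple, simpleReflection_apply] at hneg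
  have hv := hw x hx
  have h := eq_smul_simpleRoot (v := ρ w (simpleRoot x)) (x := s) fun y hy => by
    have h1 : _ ≤ (0 : ℝ) := hneg y
    have h2 : (0 : ℝ) ≤ _ := hv y
    simp only [Finsupp.sub_apply, Finsupp.smul_apply, simpleRoot,
      Finsupp.single_eq_of_ne hy, smul_zero, sub_zero] at h1
    exact le_antisymm h1 h2
  rw [M.eq_one_of_geometricRep_eq_smul (hv s) h, one_smul] at h
  exact h

theorem not_hasLabel_simple_mul {X : Set V} {w : M.Group} {s x : V} (hw : M.IsMinimalRep X w)
    (hx : x ∈ X) : ¬ M.HasLabel ((cs).simple s * w) s x := by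
  intro h
  rw [HasLabel, map_mul, LinearEquiv.mul_apply, geometricRep_simple] at h
  have h' := congr_arg (M.simpleReflection s) h
  rw [← LinearEquiv.mul_apply, simpleReflection_mul_self, simpleReflection_simpleRoot_self] at h'
  have h2 : (0 : ℝ) ≤ _ := hw x hx s
  rw [show ρ w (simpleRoot x) = -simpleRoot s from h'] at h2
  simp at h2
  linarith

/-! ### The action of the generators and the braid relations -/

section Action

variable (X : Set V) {G : Type*} [Group G] (a : V → G)

open scoped Classical in
/-- The action of a generator on pairs of a coset and a group element. -/
noncomputable def cosetStep (s : V) (b : V → G) (z : {w // M.IsMinimalRep X w} × G) :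
    {w // M.IsMinimalRep X w} × G :=
  if h : ∃ x ∈ X, M.HasLabel z.1 s x then (z.1, b h.choose * z.2)
  else (⟨(cs).simple s * z.1, z.1.2.simple_mul M fun x hx hl => h ⟨x, hx, hl⟩⟩, z.2)

variable {X}

theorem cosetStep_of_hasLabel {s x : V} (b : V → G) {z : {w // M.IsMinimalRep X w} × G}
    (hx : x ∈ X) (h : M.HasLabel z.1 s x) : M.cosetStep X s b z = (z.1, b x * z.2) := by
  have h' : ∃ x ∈ X, M.HasLabel z.1 s x := ⟨x, hx, h⟩
  rw [cosetStep, dif_pos h', h'.choose_spec.2.label_unique h]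

theorem cosetStep_of_not_hasLabel {s : V} (b : V → G) {z : {w // M.IsMinimalRep X w} × G}
    (h : ∀ x ∈ X, ¬ M.HasLabel z.1 s x) :
    M.cosetStep X s b z = (⟨(cs).simple s * z.1, z.1.2.simple_mul M h⟩, z.2) := by
  rw [cosetStep, dif_neg fun ⟨x, hx, hl⟩ => h x hx hl]

theorem cosetStep_cosetStep {s : V} {b b' : V → G} (hb : ∀ x, b' x * b x = 1)
    (z : {w // M.IsMinimalRep X w} × G) : M.cosetStep X s b' (M.cosetStep X s b z) = z := by
  by_cases h : ∃ x ∈ X, M.HasLabel z.1 s x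
  · obtain ⟨x, hx, hl⟩ := h
    rw [M.cosetStep_of_hasLabel b hx hl, M.cosetStep_of_hasLabel b' (z := (z.1, b x * z.2)) hx hl,
      ← mul_assoc, hb, one_mul]
  · push Not at h
    rw [M.cosetStep_of_not_hasLabel b h,
      M.cosetStep_of_not_hasLabel b' fun x hx => M.not_hasLabel_simple_mul z.1.2 hx]
    exact Prod.ext (Subtype.ext ((cs).simple_mul_simple_cancel_left s)) rfl

variable (X)

/-- The permutation by which a generator acts on pairs of a coset and a group element. -/
noncomputable def cosetPerm (s : V) : Equiv.Perm ({w // M.IsMinimalRep X w} × G) where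
  toFun := M.cosetStep X s a
  invFun := M.cosetStep X s a⁻¹
  left_inv := M.cosetStep_cosetStep fun x => by simp
  right_inv := M.cosetStep_cosetStep fun x => by simp

variable {X} {a}

local notation "σ" => M.cosetPerm X a

theorem cosetPerm_of_hasLabel {s x : V} {z : {w // M.IsMinimalRep X w} × G}
    (hx : x ∈ X) (h : M.HasLabel z.1 s x) : σ s z = (z.1, a x * z.2) :=
  M.cosetStep_of_hasLabel a hx h

theorem cosetPerm_of_not_hasLabel {s : V} {z : {w // M.IsMinimalRep X w} × G}
    (h : ∀ x ∈ X, ¬ M.HasLabel z.1 s x) :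
    σ s z = (⟨(cs).simple s * z.1, z.1.2.simple_mul M h⟩, z.2) :=
  M.cosetStep_of_not_hasLabel a h

theorem cosetPerm_cosetPerm {s : V} {z : {w // M.IsMinimalRep X w} × G}
    (h : ∀ x ∈ X, ¬ M.HasLabel z.1 s x) : σ s (σ s z) = z := by
  rw [M.cosetPerm_of_not_hasLabel h,
    M.cosetPerm_of_not_hasLabel fun x hx => M.not_hasLabel_simple_mul z.1.2 hx]
  exact Prod.ext (Subtype.ext ((cs).simple_mul_simple_cancel_left s)) rfl

theorem hasLabel_altElt_mul {w : M.Group} {s t x : V} {n : ℕ} :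
    M.HasLabel (M.altElt s t n * w) (altLetter s t n) x ↔
      ρ w (simpleRoot x) = sineRatio (M.edgeWeight s t) (n + 1) • simpleRoot t +
        sineRatio (M.edgeWeight s t) n • simpleRoot s := by
  rw [HasLabel, ← geometricRep_inv_altElt, map_mul, LinearEquiv.mul_apply]
  constructor <;> intro h
  · rw [← h, geometricRep_inv_apply_apply]
  · rw [h, geometricRep_apply_inv_apply]

theorem altRun_cosetPerm_of_not_hasLabel {s t : V} {z : {w // M.IsMinimalRep X w} × G} {n : ℕ}
    (h : ∀ j < n, ∀ x ∈ X, ¬ M.HasLabel (M.altElt s t j * z.1) (altLetter s t j) x) :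
    ((altRun σ s t n z).1 : M.Group) = M.altElt s t n * z.1 ∧ (altRun σ s t n z).2 = z.2 := by
  induction n with
  | zero => simp [altRun, altElt_zero]
  | succ n ih =>
    obtain ⟨h1, h2⟩ := ih fun j hj => h j (hj.trans n.lt_succ_self)
    have hn : ∀ x ∈ X, ¬ M.HasLabel (altRun σ s t n z).1 (altLetter s t n) x := by
      rw [h1]; exact h n n.lt_succ_self
    rw [altRun, Equiv.Perm.mul_apply, M.cosetPerm_of_not_hasLabel hn]
    exact ⟨by rw [altElt_succ, mul_assoc, ← h1], h2⟩

/-- Alternating words acting along a path with `m` vertices that carries a loop at either end. -/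
theorem altRun_eq_of_bounce {Ω : Type*} (τ : V → Equiv.Perm Ω) (s t : V) {m : ℕ} (Y Y' : ℕ → Ω)
    (up : ∀ i, i + 1 < m → τ (altLetter s t i) (Y i) = Y (i + 1))
    (down : ∀ i, i + 1 < m → τ (altLetter s t i) (Y (i + 1)) = Y i)
    (up' : ∀ i, i + 1 < m → τ (altLetter s t i) (Y' i) = Y' (i + 1))
    (down' : ∀ i, i + 1 < m → τ (altLetter s t i) (Y' (i + 1)) = Y' i)
    (left : τ s (Y 0) = Y' 0) (right : τ (altLetter s t (m - 1)) (Y (m - 1)) = Y' (m - 1))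
    {j : ℕ} (hj : j < m) : altRun τ s t m (Y j) = altRun τ t s m (Y j) := by
  -- One word runs m - 1 - j steps up, crosses the right loop to the copy Y', then comes down j
  -- steps; the other, in `h2`, runs j steps down, crosses the left loop, then goes up m - 1 - j
  -- steps. Both end at the same point.
  have h1 : altRun τ (altLetter s t (j + 1)) (altLetter s t j) m (Y j) = Y' (m - 1 - j) := by
    have := altRun_apply_of_steps τ (altLetter s t (j + 1)) (altLetter s t j)
      (fun k => if k + j < m then Y (j + k) else Y' (2 * m - 1 - j - k)) m ?_
    · simpa only [zero_add, hj, if_true, add_zero, show ¬ m + j < m by omega, if_false,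
        show 2 * m - 1 - j - m = m - 1 - j by omega] using this
    intro k hk
    rw [altLetter_altLetter]
    rcases lt_trichotomy (k + j + 1) m with h | h | h
    · rw [if_pos (by omega), if_pos (by omega), up _ (by omega), add_assoc]
    · rw [if_pos (by omega), if_neg (by omega), show j + k = m - 1 by omega, right]
      congr 1; omega
    · rw [if_neg (by omega), if_neg (by omega),
        show 2 * m - 1 - j - k = 2 * m - 1 - j - (k + 1) + 1 by omega,
        altLetter_congr s t (show (j + k) % 2 = (2 * m - 1 - j - (k + 1)) % 2 by omega),
        down' _ (by omega)]
  have h2 : altRun τ (altLetter s t j) (altLetter s t (j + 1)) m (Y j) = Y' (m - 1 - j) := by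
    have := altRun_apply_of_steps τ (altLetter s t j) (altLetter s t (j + 1))
      (fun k => if k ≤ j then Y (j - k) else Y' (k - j - 1)) m ?_
    · simpa only [Nat.zero_le, if_true, Nat.sub_zero, show ¬ m ≤ j by omega, if_false,
        show m - j - 1 = m - 1 - j by omega] using this
    intro k hk
    have e : altLetter (altLetter s t j) (altLetter s t (j + 1)) k = altLetter s t (j + 1 + k) := by
      rw [← altLetter_altLetter s t (j + 1) k, altLetter_congr s t (show j % 2 = (j + 1 + 1) % 2 by
        omega)]
    rw [e]
    rcases lt_trichotomy k j with h | rfl | h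
    · rw [if_pos (by omega), if_pos (by omega), show j - k = j - (k + 1) + 1 by omega,
        altLetter_congr s t (show (j + 1 + k) % 2 = (j - (k + 1)) % 2 by omega), down _ (by omega)]
    · rw [if_pos le_rfl, if_neg (by omega), altLetter_congr s t (show (k + 1 + k) % 2 = 1 % 2 by
        omega), altLetter_add_one, altLetter_zero, Nat.sub_self, left]
      congr 1; omega
    · rw [if_neg (by omega), if_neg (by omega), show k + 1 - j - 1 = k - j - 1 + 1 by omega,
        altLetter_congr s t (show (j + 1 + k) % 2 = (k - j - 1) % 2 by omega), up' _ (by omega)]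
  have h := h1.trans h2.symm
  rcases Nat.even_or_odd j with hj | hj
  · rw [altLetter_add_one] at h
    simpa only [altLetter, hj, if_true] using h
  · rw [altLetter_add_one] at h
    simpa only [altLetter, Nat.not_even_iff_odd.2 hj, if_false] using h.symm

theorem altRun_cosetPerm_of_two_labels {s t x y : V} {z : {w // M.IsMinimalRep X w} × G}
    (hx : x ∈ X) (hy : y ∈ X) (hs : M.HasLabel z.1 s x) (ht : M.HasLabel z.1 t y) (n : ℕ) :
    altRun σ s t n z = (z.1, altRun a x y n * z.2) := by
  induction n with
  | zero => simp [altRun]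
  | succ n ih =>
    rw [altRun, Equiv.Perm.mul_apply, ih, altRun, mul_assoc]
    unfold altLetter
    split_ifs
    · exact M.cosetPerm_of_hasLabel hy ht
    · exact M.cosetPerm_of_hasLabel hx hs

theorem eq_of_edgeWeight_eq {s t x y : V} (h : 2 ≤ M s t) (hxy : x ≠ y)
    (e : M.edgeWeight x y = M.edgeWeight s t) : M x y = M s t := by
  have key : ∀ {n : ℕ}, n ≠ 1 → Real.pi / n ∈ Set.Icc 0 Real.pi := by
    intro n hn
    rcases Nat.eq_zero_or_pos n with rfl | h0
    · simp [Real.pi_pos.le]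
    · have : (1 : ℝ) ≤ n := by exact_mod_cast h0
      exact ⟨by have := Real.pi_pos; positivity, div_le_self Real.pi_pos.le this⟩
  have h1 := Real.injOn_cos (key (M.off_diagonal x y hxy)) (key (by omega))
    (mul_left_cancel₀ two_ne_zero e)
  rw [div_eq_mul_inv, div_eq_mul_inv] at h1
  exact_mod_cast inv_injective (mul_left_cancel₀ Real.pi_ne_zero h1)

/-- A label z would give α_z = cβ + dα_x with c, d > 0 and β = f⁻¹α_t. The x-coordinate of β is then
negative and its z-coordinate positive, impossible for a root. -/
theorem not_hasLabel_altElt_of_label {f : M.Group} {s t x z : V} {i : ℕ} (hst : 2 ≤ M s t)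
    (hne : s ≠ t) (hs : M.HasLabel f s x) (ht : ¬ M.HasLabel f t z) (hi : i + 1 < M s t) :
    ¬ M.HasLabel (M.altElt s t i * f) (altLetter s t i) z := by
  intro h
  rcases Nat.eq_zero_or_pos i with rfl | h0
  · rw [altElt_zero, one_mul, altLetter_zero] at h
    exact ht h
  rw [hasLabel_altElt_mul] at h
  set c := sineRatio (M.edgeWeight s t) (i + 1) with hc
  set d := sineRatio (M.edgeWeight s t) i with hd
  have hcpos : 0 < c := sineRatio_pos hst (by omega) hi
  have hdpos : 0 < d := sineRatio_pos hst h0 (by omega)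
  have hzx : z ≠ x := by
    rintro rfl
    rw [hs] at h
    have := DFunLike.congr_fun h t
    simp [hne] at this
    exact hcpos.ne this
  have h' : simpleRoot z = c • ρ f⁻¹ (simpleRoot t) + d • simpleRoot x := by
    rw [← M.geometricRep_inv_apply_apply f (simpleRoot x), hs, ← map_smul, ← map_smul, ← map_add,
      ← h, geometricRep_inv_apply_apply]
  set β := ρ f⁻¹ (simpleRoot t) with hβdef
  clear_value β
  have hx := DFunLike.congr_fun h' x
  have hz := DFunLike.congr_fun h' z
  simp [hzx, hzx.symm] at hx hz
  rcases (hβdef ▸ M.geometricRep_nonneg_or_nonpos f⁻¹ t : 0 ≤ β ∨ β ≤ 0) with hβ | hβ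
  · have : (0 : ℝ) ≤ _ := hβ x
    nlinarith
  · have : _ ≤ (0 : ℝ) := hβ z
    nlinarith

/-- If s and t both fix the coset, with labels x and y, invariance of the form gives M x y = M s t
and the relation reduces to that of `a`. Otherwise the dihedral orbit is a path with loops only at
its ends, both labeled x, and the bounce argument applies. -/
theorem altRun_cosetPerm_of_hasLabel
    (ha : ∀ x y, 2 ≤ M x y → altRun a x y (M x y) = altRun a y x (M x y))
    {s t x : V} (hst : 2 ≤ M s t) {j : ℕ}
    (hj : j < M s t) (z : {w // M.IsMinimalRep X w} × G) (hx : x ∈ X) (hs : M.HasLabel z.1 s x) :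
    altRun σ s t (M s t) (altRun σ s t j z) = altRun σ t s (M s t) (altRun σ s t j z) := by
  have hne : s ≠ t := by rintro rfl; simp at hst
  by_cases ht : ∃ y ∈ X, M.HasLabel z.1 t y
  · obtain ⟨y, hy, ht⟩ := ht
    have hxy : x ≠ y := by
      rintro rfl
      exact hne (Finsupp.single_left_injective one_ne_zero (hs.symm.trans ht))
    have hM : M x y = M s t := by
      refine M.eq_of_edgeWeight_eq hst hxy (neg_injective ?_)
      rw [← form_simpleRoot, ← form_simpleRoot, ← M.form_geometricRep z.1, hs, ht]
    rw [M.altRun_cosetPerm_of_two_labels hx hy hs ht,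
      M.altRun_cosetPerm_of_two_labels (z := (z.1, altRun a x y j * z.2)) hx hy hs ht,
      M.altRun_cosetPerm_of_two_labels (z := (z.1, altRun a x y j * z.2)) hy hx ht hs, ← hM,
      ha x y (hM ▸ hst)]
  push Not at ht
  have free : ∀ i, i + 1 < M s t → ∀ y ∈ X,
      ¬ M.HasLabel (M.altElt s t i * z.1) (altLetter s t i) y := fun i hi y hy =>
    M.not_hasLabel_altElt_of_label hst hne hs (ht y hy) hi
  have pos : ∀ g : G, ∀ i < M s t,
      ((altRun σ s t i (z.1, g)).1 : M.Group) = M.altElt s t i * z.1 ∧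
        (altRun σ s t i (z.1, g)).2 = g := fun g i hi =>
    M.altRun_cosetPerm_of_not_hasLabel (z := (z.1, g)) fun k hk => free k (by omega)
  have up : ∀ g : G, ∀ i, σ (altLetter s t i) (altRun σ s t i (z.1, g)) =
      altRun σ s t (i + 1) (z.1, g) := fun g i => rfl
  have down : ∀ g : G, ∀ i, i + 1 < M s t →
      σ (altLetter s t i) (altRun σ s t (i + 1) (z.1, g)) = altRun σ s t i (z.1, g) := by
    intro g i hi
    rw [← up, M.cosetPerm_cosetPerm]
    rw [(pos g i (by omega)).1]
    exact free i hi
  refine altRun_eq_of_bounce σ s t (fun i => altRun σ s t i (z.1, z.2))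
    (fun i => altRun σ s t i (z.1, a x * z.2)) (fun i _ => up _ i) (down _) (fun i _ => up _ i)
    (down _) (M.cosetPerm_of_hasLabel hx hs) ?_ hj
  -- The sine ratios at M s t and M s t - 1 are 0 and 1, so the far end carries the same label x.
  have hlast : M.HasLabel (altRun σ s t (M s t - 1) (z.1, z.2)).1
      (altLetter s t (M s t - 1)) x := by
    rw [(pos _ _ (by omega)).1, hasLabel_altElt_mul, Nat.sub_add_cancel (by omega), edgeWeight,
      sineRatio_self hst, sineRatio_pred hst, zero_smul, zero_add, one_smul]
    exact hs
  obtain ⟨h1, h2⟩ := pos z.2 (M s t - 1) (by omega)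
  obtain ⟨h3, h4⟩ := pos (a x * z.2) (M s t - 1) (by omega)
  rw [M.cosetPerm_of_hasLabel hx hlast]
  exact Prod.ext (Subtype.ext (h1.trans h3.symm)) (by rw [h2, h4])

/-- The first fixed coset met along the word is an end of the path; retracing the free moves from
there exhibits z as its j-th point. -/
theorem altRun_cosetPerm_of_exists
    (ha : ∀ x y, 2 ≤ M x y → altRun a x y (M x y) = altRun a y x (M x y))
    {s t : V} (hst : 2 ≤ M s t)
    (z : {w // M.IsMinimalRep X w} × G)
    (h : ∃ j < M s t, ∃ x ∈ X, M.HasLabel (M.altElt s t j * z.1) (altLetter s t j) x) :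
    altRun σ s t (M s t) z = altRun σ t s (M s t) z := by
  classical
  obtain ⟨hj, x, hx, hl⟩ := Nat.find_spec h
  set j := Nat.find h with hjdef
  have hmin : ∀ i < j, ∀ y ∈ X, ¬ M.HasLabel (M.altElt s t i * z.1) (altLetter s t i) y :=
    fun i hi y hy hl' => Nat.find_min h hi ⟨hi.trans hj, y, hy, hl'⟩
  have pos : ∀ i ≤ j, ((altRun σ s t i z).1 : M.Group) = M.altElt s t i * z.1 := fun i hi =>
    (M.altRun_cosetPerm_of_not_hasLabel fun k hk => hmin k (by omega)).1
  have back : altRun σ (altLetter s t j) (altLetter s t (j + 1)) j (altRun σ s t j z) = z := by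
    have := altRun_apply_of_steps σ (altLetter s t j) (altLetter s t (j + 1))
      (fun k => altRun σ s t (j - k) z) j ?_
    · simpa only [Nat.sub_zero, Nat.sub_self, altRun, Equiv.Perm.one_apply] using this
    intro k hk
    have e : altLetter (altLetter s t j) (altLetter s t (j + 1)) k = altLetter s t (j + 1 + k) := by
      rw [← altLetter_altLetter s t (j + 1) k, altLetter_congr s t (show j % 2 = (j + 1 + 1) % 2 by
        omega)]
    rw [e, show j - k = j - (k + 1) + 1 by omega,
      altLetter_congr s t (show (j + 1 + k) % 2 = (j - (k + 1)) % 2 by omega), altRun,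
      Equiv.Perm.mul_apply, M.cosetPerm_cosetPerm]
    rw [pos _ (by omega)]
    exact hmin _ (by omega)
  rw [← pos j le_rfl] at hl
  rw [← back]
  rw [altLetter_add_one] at back ⊢
  rcases Nat.even_or_odd j with hp | hp
  · simp only [altLetter, hp, if_true] at hl ⊢
    have hts : 2 ≤ M t s := by rwa [M.symmetric]
    have := M.altRun_cosetPerm_of_hasLabel ha hts (j := j) (by rwa [M.symmetric]) _ hx hl
    rw [M.symmetric s t]
    exact this.symm
  · simp only [altLetter, Nat.not_even_iff_odd.2 hp, if_false] at hl ⊢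
    exact M.altRun_cosetPerm_of_hasLabel ha hst hj _ hx hl

theorem altRun_cosetPerm_comm
    (ha : ∀ x y, 2 ≤ M x y → altRun a x y (M x y) = altRun a y x (M x y))
    {s t : V} (hst : 2 ≤ M s t) :
    altRun σ s t (M s t) = altRun σ t s (M s t) := by
  ext1 z
  by_cases h1 : ∃ j < M s t, ∃ x ∈ X, M.HasLabel (M.altElt s t j * z.1) (altLetter s t j) x
  · exact M.altRun_cosetPerm_of_exists ha hst z h1
  by_cases h2 : ∃ j < M t s, ∃ x ∈ X, M.HasLabel (M.altElt t s j * z.1) (altLetter t s j) x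
  · rw [M.symmetric s t]
    exact (M.altRun_cosetPerm_of_exists ha (by rwa [M.symmetric]) z h2).symm
  push Not at h1 h2
  rw [M.symmetric t s] at h2
  obtain ⟨h3, h4⟩ := M.altRun_cosetPerm_of_not_hasLabel (a := a) (z := z) h1
  obtain ⟨h5, h6⟩ := M.altRun_cosetPerm_of_not_hasLabel (a := a) (z := z) h2
  exact Prod.ext (Subtype.ext (by rw [h3, h5, altElt_comm])) (h4.trans h6.symm)

end Action

end CoxeterMatrix

/-! ### The action of the Artin group -/

namespace LabeledGraph

variable {V : Type*} (Γ : LabeledGraph V)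

open scoped Classical in
/-- The entries of the Coxeter matrix of a labeled graph, with `0` standing for `∞`. -/
noncomputable def coxeterEntry (s t : V) : ℕ :=
  if s = t then 1 else if h : Γ.graph.Adj s t then Γ.m ⟨s(s, t), h⟩ else 0

theorem coxeterEntry_comm (s t : V) : Γ.coxeterEntry s t = Γ.coxeterEntry t s := by
  unfold coxeterEntry
  have hm : ∀ (h : Γ.graph.Adj s t), Γ.m ⟨s(s, t), h⟩ = Γ.m ⟨s(t, s), h.symm⟩ := fun h =>
    congr_arg Γ.m (Subtype.ext Sym2.eq_swap)
  by_cases hst : s = t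
  · rw [if_pos hst, if_pos hst.symm]
  by_cases h : Γ.graph.Adj s t
  · rw [if_neg hst, if_neg (Ne.symm hst), dif_pos h, dif_pos h.symm, hm]
  · rw [if_neg hst, if_neg (Ne.symm hst), dif_neg h, dif_neg fun h' => h h'.symm]

/-- The Coxeter matrix of a labeled graph. -/
noncomputable def coxeterMatrix : CoxeterMatrix V where
  M := Matrix.of Γ.coxeterEntry
  isSymm := Matrix.IsSymm.ext fun s t => Γ.coxeterEntry_comm t s
  diagonal s := if_pos rfl
  off_diagonal s t hst := by
    rw [Matrix.of_apply, coxeterEntry, if_neg hst]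
    split_ifs with h
    · have := Γ.two_le_m ⟨s(s, t), h⟩
      omega
    · simp

theorem coxeterMatrix_of_adj {s t : V} (h : Γ.graph.Adj s t) :
    Γ.coxeterMatrix s t = Γ.m ⟨s(s, t), h⟩ := by
  change Γ.coxeterEntry s t = _
  rw [coxeterEntry, if_neg h.ne, dif_pos h]

theorem adj_of_two_le_coxeterMatrix {s t : V} (h : 2 ≤ Γ.coxeterMatrix s t) :
    Γ.graph.Adj s t := by
  change 2 ≤ Γ.coxeterEntry s t at h
  by_contra hadj
  rw [coxeterEntry, dif_neg hadj] at h
  split_ifs at h <;> omega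

/-- The standard generators of the Artin group. -/
abbrev gen (s : V) : Γ.ArtinGroup := PresentedGroup.of s

theorem map_altProd {G H : Type*} [Monoid G] [Monoid H] (f : G →* H) (a b : G) (n : ℕ) :
    f (altProd a b n) = altProd (f a) (f b) n := by
  induction n generalizing a b with
  | zero => simp [altProd]
  | succ n ih => rw [altProd, map_mul, ih, altProd]

theorem altRun_gen_comm (s t : V) (h : 2 ≤ Γ.coxeterMatrix s t) :
    CoxeterMatrix.altRun Γ.gen s t (Γ.coxeterMatrix s t) =
      CoxeterMatrix.altRun Γ.gen t s (Γ.coxeterMatrix s t) := by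
  have hadj := Γ.adj_of_two_le_coxeterMatrix h
  rw [← CoxeterMatrix.altProd_comm_iff, Γ.coxeterMatrix_of_adj hadj, ← mul_inv_eq_one]
  have := PresentedGroup.one_of_mem (rels := Γ.artinRels) ⟨s, t, hadj, rfl⟩
  rwa [map_mul, map_inv, map_altProd, map_altProd] at this

/-- The states on which the Artin group acts: pairs of a left coset of the standard parabolic
subgroup of the Coxeter group and an element of the Artin group. -/
abbrev State (X : Set V) : Type _ := {w // Γ.coxeterMatrix.IsMinimalRep X w} × Γ.ArtinGroup

/-- The action of the Artin group on the states. -/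
noncomputable def stateHom (X : Set V) : Γ.ArtinGroup →* Equiv.Perm (Γ.State X) :=
  PresentedGroup.toGroup (f := Γ.coxeterMatrix.cosetPerm X Γ.gen) <| by
    rintro _ ⟨s, t, h, rfl⟩
    rw [map_mul, map_inv, map_altProd, map_altProd, FreeGroup.lift_apply_of,
      FreeGroup.lift_apply_of, mul_inv_eq_one, ← Γ.coxeterMatrix_of_adj h,
      CoxeterMatrix.altProd_comm_iff]
    refine Γ.coxeterMatrix.altRun_cosetPerm_comm Γ.altRun_gen_comm ?_
    rw [Γ.coxeterMatrix_of_adj h]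
    exact Γ.two_le_m _

variable {X : Set V}

theorem stateHom_gen (s : V) :
    Γ.stateHom X (Γ.gen s) = Γ.coxeterMatrix.cosetPerm X Γ.gen s :=
  PresentedGroup.toGroup.of _

theorem gen_induction {p : Γ.ArtinGroup → Prop} (gen : ∀ s, p (Γ.gen s)) (one : p 1)
    (mul : ∀ g h, p g → p h → p (g * h)) (inv : ∀ g, p g → p g⁻¹) (g : Γ.ArtinGroup) : p g := by
  have hg : g ∈ Subgroup.closure (Set.range Γ.gen) := by
    rw [PresentedGroup.closure_range_of]; trivial
  induction hg using Subgroup.closure_induction with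
  | mem _ h => obtain ⟨s, rfl⟩ := h; exact gen s
  | one => exact one
  | mul g h _ _ hg hh => exact mul g h hg hh
  | inv g _ hg => exact inv g hg

theorem stateHom_mul_right (g b : Γ.ArtinGroup) (z : Γ.State X) :
    Γ.stateHom X g (z.1, z.2 * b) = ((Γ.stateHom X g z).1, (Γ.stateHom X g z).2 * b) := by
  induction g using Γ.gen_induction generalizing z with
  | gen s =>
    rw [stateHom_gen]
    by_cases h : ∃ x ∈ X, Γ.coxeterMatrix.HasLabel z.1 s x
    · obtain ⟨x, hx, hl⟩ := h
      rw [CoxeterMatrix.cosetPerm_of_hasLabel _ hx hl,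
        CoxeterMatrix.cosetPerm_of_hasLabel _ (z := (z.1, z.2 * b)) hx hl, mul_assoc]
    · push Not at h
      rw [CoxeterMatrix.cosetPerm_of_not_hasLabel _ h,
        CoxeterMatrix.cosetPerm_of_not_hasLabel _ (z := (z.1, z.2 * b)) h]
  | one => simp
  | mul g h hg hh => rw [map_mul, Equiv.Perm.mul_apply, Equiv.Perm.mul_apply, hh, hg]
  | inv g hg =>
    rw [map_inv, Equiv.Perm.inv_eq_iff_eq, hg, ← Equiv.Perm.mul_apply, mul_inv_cancel, Equiv.Perm.one_apply]

/-- The second coordinate is only ever multiplied on the left by generators from X or their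
inverses. -/
theorem stateHom_snd_mem_iff (g : Γ.ArtinGroup) (z : Γ.State X) :
    (Γ.stateHom X g z).2 ∈ Γ.standardParabolic X ↔ z.2 ∈ Γ.standardParabolic X := by
  induction g using Γ.gen_induction generalizing z with
  | gen s =>
    rw [stateHom_gen]
    by_cases h : ∃ x ∈ X, Γ.coxeterMatrix.HasLabel z.1 s x
    · obtain ⟨x, hx, hl⟩ := h
      rw [CoxeterMatrix.cosetPerm_of_hasLabel _ hx hl]
      exact Subgroup.mul_mem_cancel_left _ (Subgroup.subset_closure ⟨x, hx, rfl⟩)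
    · push Not at h
      rw [CoxeterMatrix.cosetPerm_of_not_hasLabel _ h]
  | one => simp
  | mul g h hg hh => rw [map_mul, Equiv.Perm.mul_apply, hg, hh]
  | inv g hg => rw [← hg, map_inv, ← Equiv.Perm.mul_apply, mul_inv_cancel, Equiv.Perm.one_apply]

/-- The state formed by the trivial coset and the group element `b`. -/
noncomputable def baseState (X : Set V) (b : Γ.ArtinGroup) : Γ.State X :=
  (⟨1, Γ.coxeterMatrix.isMinimalRep_one X⟩, b)

theorem stateHom_baseState {g : Γ.ArtinGroup} (hg : g ∈ Γ.standardParabolic X)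
    (b : Γ.ArtinGroup) : Γ.stateHom X g (Γ.baseState X b) = Γ.baseState X (g * b) := by
  induction hg using Subgroup.closure_induction generalizing b with
  | mem _ h =>
    obtain ⟨x, hx, rfl⟩ := h
    rw [stateHom_gen]
    exact Γ.coxeterMatrix.cosetPerm_of_hasLabel (z := Γ.baseState X b) hx
      (by simp [CoxeterMatrix.HasLabel, baseState])
  | one => simp
  | mul g h _ _ hg hh => rw [map_mul, Equiv.Perm.mul_apply, hh, hg, mul_assoc]
  | inv g _ hg => rw [map_inv, Equiv.Perm.inv_eq_iff_eq, hg, mul_inv_cancel_left]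

theorem exists_hasLabel_of_stateHom_fst_eq {s : V} {z : Γ.State X}
    (h : (Γ.stateHom X (Γ.gen s) z).1 = z.1) :
    ∃ x ∈ X, Γ.coxeterMatrix.HasLabel z.1 s x := by
  by_contra! hl
  rw [stateHom_gen, CoxeterMatrix.cosetPerm_of_not_hasLabel _ hl, Subtype.ext_iff] at h
  have h1 := Γ.coxeterMatrix.toCoxeterSystem.length_simple s
  rw [mul_eq_right.1 h, CoxeterSystem.length_one] at h1
  exact zero_ne_one h1

/-! ### Rigidity of conjugates and the descending chain condition -/

theorem map_conj_standardParabolic_eq_of_le [Finite V] {g : Γ.ArtinGroup}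
    (hg : (Γ.standardParabolic X).map (MulAut.conj g).toMonoidHom ≤ Γ.standardParabolic X) :
    (Γ.standardParabolic X).map (MulAut.conj g).toMonoidHom = Γ.standardParabolic X := by
  refine le_antisymm hg ?_
  set z := Γ.stateHom X g⁻¹ (Γ.baseState X 1) with hz
  have hh : z.2 ∈ Γ.standardParabolic X :=
    (Γ.stateHom_snd_mem_iff g⁻¹ _).2 (one_mem _)
  -- Write xg⁻¹ = g⁻¹(gxg⁻¹): the bracket lies in A_X, so it keeps the trivial coset, and right
  -- multiplication commutes with the action.
  have hfix : ∀ x ∈ X, Γ.stateHom X (Γ.gen x) z = (z.1, z.2 * (g * Γ.gen x * g⁻¹)) := by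
    intro x hx
    have hmem : g * Γ.gen x * g⁻¹ ∈ Γ.standardParabolic X :=
      hg ⟨Γ.gen x, Subgroup.subset_closure ⟨x, hx, rfl⟩, rfl⟩
    rw [hz, ← stateHom_mul_right, ← Equiv.Perm.mul_apply, ← map_mul]
    change _ = Γ.stateHom X g⁻¹ (Γ.baseState X (1 * _))
    rw [one_mul, ← mul_one (g * Γ.gen x * g⁻¹), ← Γ.stateHom_baseState hmem,
      ← Equiv.Perm.mul_apply, ← map_mul]
    congr 2
    group
  have hlabel : ∀ x : X, ∃ y : X, Γ.coxeterMatrix.HasLabel z.1 x y := fun x => by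
    obtain ⟨y, hy, hl⟩ := Γ.exists_hasLabel_of_stateHom_fst_eq (z := z) (s := x)
      (by rw [hfix x x.2])
    exact ⟨⟨y, hy⟩, hl⟩
  choose φ hφ using hlabel
  have hφinj : Function.Injective φ := fun x x' h => Subtype.ext <|
    Finsupp.single_left_injective one_ne_zero ((hφ x).symm.trans (h ▸ hφ x'))
  have hconj : ∀ x : X, Γ.gen (φ x) * z.2 = z.2 * (g * Γ.gen x * g⁻¹) := fun x => by
    have h := hfix x x.2
    rw [stateHom_gen, CoxeterMatrix.cosetPerm_of_hasLabel _ (φ x).2 (hφ x)] at h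
    exact congr_arg Prod.snd h
  have hle : Γ.standardParabolic X ≤
      (Γ.standardParabolic X).map (MulAut.conj (z.2 * g)).toMonoidHom := by
    refine (Subgroup.closure_le _).2 ?_
    rintro _ ⟨y, hy, rfl⟩
    obtain ⟨x, hx⟩ := Finite.surjective_of_injective hφinj ⟨y, hy⟩
    refine ⟨Γ.gen x, Subgroup.subset_closure ⟨x, x.2, rfl⟩, ?_⟩
    have h := hconj x
    rw [hx, ← eq_mul_inv_iff_mul_eq] at h
    change z.2 * g * Γ.gen x * (z.2 * g)⁻¹ = Γ.gen y
    rw [h]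
    group
  intro b hb
  -- As z.2 ∈ A_X, conjugating b by it stays in A_X; it is then cancelled from both sides.
  obtain ⟨c, hc, h⟩ := hle (mul_mem (mul_mem hh hb) (inv_mem hh))
  refine ⟨c, hc, ?_⟩
  change z.2 * g * c * (z.2 * g)⁻¹ = z.2 * b * z.2⁻¹ at h
  change g * c * g⁻¹ = b
  rw [mul_inv_rev, ← mul_assoc, mul_left_inj, mul_assoc, mul_assoc, mul_right_inj] at h
  rw [mul_assoc, h]

theorem map_conj_standardParabolic_antisymm [Finite V] {g g' : Γ.ArtinGroup}
    (h : (Γ.standardParabolic X).map (MulAut.conj g).toMonoidHom ≤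
      (Γ.standardParabolic X).map (MulAut.conj g').toMonoidHom) :
    (Γ.standardParabolic X).map (MulAut.conj g).toMonoidHom =
      (Γ.standardParabolic X).map (MulAut.conj g').toMonoidHom := by
  have e : (MulAut.conj g).toMonoidHom =
      (MulAut.conj g').toMonoidHom.comp (MulAut.conj (g'⁻¹ * g)).toMonoidHom := by
    ext a
    simp [mul_assoc]
  rw [e, ← Subgroup.map_map] at h ⊢
  rw [Subgroup.map_le_map_iff_of_injective (MulAut.conj g').injective] at h
  rw [Γ.map_conj_standardParabolic_eq_of_le h]

theorem wellFounded_isParabolic [Finite V] :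
    WellFounded fun P Q : {P // Γ.IsParabolic P} => P < Q := by
  rw [wellFounded_iff_isEmpty_descending_chain]
  refine ⟨fun ⟨f, hf⟩ => ?_⟩
  have hanti : StrictAnti f := strictAnti_nat_of_succ_lt hf
  choose g X hgX using fun n => (f n).2
  obtain ⟨i, j, hij, hX⟩ := Finite.exists_ne_map_eq_of_infinite X
  wlog h : i < j generalizing i j
  · exact this j i hij.symm hX.symm (by omega)
  have hlt : (f j : Subgroup Γ.ArtinGroup) < f i := hanti h
  rw [hgX i, hgX j, hX] at hlt
  exact hlt.ne (Γ.map_conj_standardParabolic_antisymm hlt.le)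

theorem isParabolic_top : Γ.IsParabolic ⊤ := by
  refine ⟨1, Set.univ, ?_⟩
  rw [standardParabolic, Set.image_univ, PresentedGroup.closure_range_of,
    Subgroup.map_top_of_surjective _ (MulAut.conj (1 : Γ.ArtinGroup)).surjective]

variable {Γ} in
theorem IntPlusPlus.isParabolic_sInf [Finite V] (hΓ : Γ.IntPlusPlus)
    {N : Set (Subgroup Γ.ArtinGroup)} (hN : ∀ P ∈ N, Γ.IsParabolic P) :
    Γ.IsParabolic (sInf N) := by
  obtain ⟨⟨Q, hQ⟩, hmem, hmin⟩ := Γ.wellFounded_isParabolic.has_min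
    {Q | sInf N ≤ Q.1} ⟨⟨⊤, Γ.isParabolic_top⟩, by simp⟩
  have hle : Q ≤ sInf N := le_sInf fun P hP => by
    by_contra hQP
    exact hmin ⟨Q ⊓ P, hΓ Q P hQ (hN P hP)⟩ (le_inf hmem (sInf_le hP))
      (inf_lt_left.2 hQP)
  rwa [le_antisymm hmem hle]

end LabeledGraph

theorem mainTheorem8 {V : Type*} [Finite V] (Γ : LabeledGraph V) (hΓ : Γ.IntPlusPlus) :
    (∀ N : Set (Subgroup Γ.ArtinGroup), (∀ P ∈ N, Γ.IsParabolic P) → Γ.IsParabolic (sInf N)) ∧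
      ∀ B : Set Γ.ArtinGroup, ∃ P : Subgroup Γ.ArtinGroup, Γ.IsParabolicClosure B P := by
  refine ⟨fun N hN => hΓ.isParabolic_sInf hN, fun B => ?_⟩
  set N : Set (Subgroup Γ.ArtinGroup) := {Q | Γ.IsParabolic Q ∧ B ⊆ (Q : Set Γ.ArtinGroup)} with hN
  have hP : Γ.IsParabolic (sInf N) ∧ B ⊆ (sInf N : Subgroup Γ.ArtinGroup) :=
    ⟨hΓ.isParabolic_sInf fun Q hQ => hQ.1, fun b hb => Subgroup.mem_sInf.2 fun Q hQ => hQ.2 hb⟩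
  exact ⟨sInf N, ⟨hP, fun Q hQ _ => sInf_le hQ⟩, fun Q hQ => hQ.eq_of_ge hP (sInf_le hQ.1)⟩
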